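/- Two players share a set $M=[m]$ of $m$ indivisible items; player $i$ has an additive valuation $v_i$ with $v_i(\{j\})>0$ for every item $j$. A mechanism (allocating all items, without payments) maps every profile $\mathbf v=(v_1,v_2)$ of such valuations to an ordered partition $(X_1(\mathbf v),X_2(\mathbf v))$ of $M$ with possibly empty parts. It is truthful if no player can increase the value of her own bundle, measured by her true valuation, by reporting another valuation. It achieves envy-freeness up to one item if for every profile $\mathbf v$ and for $\{i,j\}=\{1,2\}$, either $X_j(\mathbf v)=\emptyset$ or $v_i(X_i(\mathbf v))\ge v_i(X_j(\mathbf v)\setminus\{a\})$ for some $a\in X_j(\mathbf v)$. A set of offers on $S\subseteq M$ is, if $S\ne\emptyset$, a nonempty collection of proper subsets of $S$ with union $S$ and empty intersection; on $S=\emptyset$ it is $\{\emptyset\}$. A mechanism is a picking-exchange mechanism if there are a partition $(N_1,N_2,E_1,E_2)$ of $M$ (with possibly empty parts), sets of offers $\mathcal O_i$ on $N_i$ for $i\in\{1,2\}$, and $k\ge 0$ exchange deals $(S_1,T_1),\dots,(S_k,T_k)$, where $S_1,\dots,S_k$ are nonempty pairwise disjoint subsets of $E_1$ and $T_1,\dots,T_k$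 are nonempty pairwise disjoint subsets of $E_2$, such that for every profile $\mathbf v$ we have $X_i(\mathbf v)\cap N_i\in\operatorname{arg\,max}_{S\in\mathcal O_i}v_i(S)$ for $i\in\{1,2\}$, and $$X_1(\mathbf v)\cap(E_1\cup E_2)=\Big(E_1\setminus\bigcup_{l\in I}S_l\Big)\cup\bigcup_{l\in I}T_l$$ for some $I=I(\mathbf v)\subseteq[k]$ that contains every $l$ with $v_1(T_l)>v_1(S_l)$ and $v_2(T_l)<v_2(S_l)$, and no $l$ with $v_1(T_l)<v_1(S_l)$ or $v_2(T_l)>v_2(S_l)$. It is a singleton picking-exchange mechanism if these can be chosen so that, in addition, for each $i\in\{1,2\}$ at most one of $N_i,E_i$ is nonempty, $|E_i|\le 1$, and $\mathcal O_i=\{\{x\}: x\in N_i\}$ if $N_i\neq\emptyset$ and $\mathcal O_i=\{\emptyset\}$ otherwise. Then: 1. For $m\le 3$, every singleton picking-exchange mechanism achieves envy-freeness up to one item. 2. For $m=4$, every singleton picking-exchange mechanism with $|N_1|=|N_2|=2$ achieves envy-freeness up to one item. 3. For $m\ge 5$, there is no truthful mechanism that allocates all the items to the two players and achieves envy-freeness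 up to one item. -/

import Mathlib

/-- The valuation of one player on the items `Fin m`: every single item has a strictly positive
value. -/
abbrev ItemValuation (m : ℕ) : Type := {v : Fin m → ℝ // ∀ j, 0 < v j}

/-- The additive extension of a valuation to sets of items. -/
noncomputable def ItemValuation.value {m : ℕ} (v : ItemValuation m) (S : Finset (Fin m)) : ℝ :=
  ∑ j ∈ S, v.1 j

/-- A profile: one valuation for each of the two players (player `0` and player `1`). -/
abbrev Profile (m : ℕ) : Type := Fin 2 → ItemValuation m

/-- An allocation of all the items to the two players: an ordered partition of the items into two
(possibly empty) bundles. -/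
structure Allocation (m : ℕ) where
  bundle : Fin 2 → Finset (Fin m)
  disjoint : Disjoint (bundle 0) (bundle 1)
  cover : bundle 0 ∪ bundle 1 = Finset.univ

/-- A deterministic mechanism without payments that allocates all the items to two players. -/
abbrev Mechanism (m : ℕ) : Type := Profile m → Allocation m

/-- No player can ever gain by reporting another valuation. -/
def Mechanism.IsTruthful {m : ℕ} (X : Mechanism m) : Prop :=
  ∀ (v : Profile m) (i : Fin 2) (v' : ItemValuation m),
    (v i).value ((X (Function.update v i v')).bundle i) ≤ (v i).value ((X v).bundle i)

/-- Envy-freeness up to one item: each player values her own bundle at least as much as the other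
player's bundle after the removal of some item from it. An empty bundle is not envied. -/
def Allocation.IsEF1 {m : ℕ} (A : Allocation m) (v : Profile m) : Prop :=
  ∀ i j : Fin 2, i ≠ j → (A.bundle j).Nonempty →
    ∃ a ∈ A.bundle j, (v i).value (A.bundle j \ {a}) ≤ (v i).value (A.bundle i)

/-- A mechanism achieves envy-freeness up to one item if its outcome does at every profile. -/
def Mechanism.AchievesEF1 {m : ℕ} (X : Mechanism m) : Prop :=
  ∀ v : Profile m, (X v).IsEF1 v

/-- `O` is a set of offers on `S`: a nonempty collection of proper subsets of `S` with union `S`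
and with empty intersection. For `S = ∅` the only set of offers is `{∅}`. -/
structure IsSetOfOffers {m : ℕ} (O : Finset (Finset (Fin m))) (S : Finset (Fin m)) : Prop where
  nonempty : O.Nonempty
  subset : ∀ T ∈ O, T ⊆ S
  proper : S.Nonempty → ∀ T ∈ O, T ≠ S
  cover : O.biUnion id = S
  no_common : ∀ x, ∃ T ∈ O, x ∉ T

/-- `T` is one of the offers in `O` of largest value. -/
def IsBestOffer {m : ℕ} (v : ItemValuation m) (O : Finset (Finset (Fin m))) (T : Finset (Fin m)) :
    Prop :=
  T ∈ O ∧ ∀ T' ∈ O, v.value T' ≤ v.value T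

/-- The deal that exchanges `S` (held by player `0`) for `T` (held by player `1`) strictly improves
both players. -/
def IsFavorable {m : ℕ} (v : Profile m) (S T : Finset (Fin m)) : Prop :=
  (v 0).value S < (v 0).value T ∧ (v 1).value T < (v 1).value S

/-- The deal that exchanges `S` (held by player `0`) for `T` (held by player `1`) strictly hurts
some player. -/
def IsUnfavorable {m : ℕ} (v : Profile m) (S T : Finset (Fin m)) : Prop :=
  (v 0).value T < (v 0).value S ∨ (v 1).value S < (v 1).value T

/-- The parameters of a picking-exchange mechanism: a partition `(N 0, N 1, E 0, E 1)` of the items,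
sets of offers `O i` on `N i`, and a valid set of exchange deals `(S l, T l)` on `(E 0, E 1)`. -/
structure PickingExchangeData (m : ℕ) where
  N : Fin 2 → Finset (Fin m)
  E : Fin 2 → Finset (Fin m)
  disjoint_N : Disjoint (N 0) (N 1)
  disjoint_E : Disjoint (E 0) (E 1)
  disjoint_N_E : ∀ i j, Disjoint (N i) (E j)
  cover : N 0 ∪ N 1 ∪ E 0 ∪ E 1 = Finset.univ
  O : Fin 2 → Finset (Finset (Fin m))
  offers : ∀ i, IsSetOfOffers (O i) (N i)
  k : ℕ
  S : Fin k → Finset (Fin m)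
  T : Fin k → Finset (Fin m)
  S_nonempty : ∀ l, (S l).Nonempty
  T_nonempty : ∀ l, (T l).Nonempty
  S_subset : ∀ l, S l ⊆ E 0
  T_subset : ∀ l, T l ⊆ E 1
  S_disjoint : ∀ l l', l ≠ l' → Disjoint (S l) (S l')
  T_disjoint : ∀ l l', l ≠ l' → Disjoint (T l) (T l')

/-- `X` is a picking-exchange mechanism with parameters `P`: at every profile, player `i` gets from
`N i` a best offer of `O i`, and on `E 0 ∪ E 1` a set `I` of deals is performed that contains every
favorable deal and no unfavorable one. -/
def Mechanism.IsPickingExchangeWith {m : ℕ} (X : Mechanism m) (P : PickingExchangeData m) : Prop :=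
  ∀ v : Profile m,
    (∀ i, IsBestOffer (v i) (P.O i) ((X v).bundle i ∩ P.N i)) ∧
    ∃ I : Finset (Fin P.k),
      (X v).bundle 0 ∩ (P.E 0 ∪ P.E 1) = (P.E 0 \ I.biUnion P.S) ∪ I.biUnion P.T ∧
      (∀ l, IsFavorable v (P.S l) (P.T l) → l ∈ I) ∧
      (∀ l, IsUnfavorable v (P.S l) (P.T l) → l ∉ I)

/-- The parameters are singleton ones: for each player `i`, at most one of `N i` and `E i` is
nonempty, `E i` has at most one item, and the offers are all the singletons in `N i` (only `∅` if
`N i = ∅`). -/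
def PickingExchangeData.IsSingleton {m : ℕ} (P : PickingExchangeData m) : Prop :=
  ∀ i : Fin 2, (P.N i = ∅ ∨ P.E i = ∅) ∧ (P.E i).card ≤ 1 ∧
    P.O i = if (P.N i).Nonempty then (P.N i).image (fun x => {x}) else {∅}

/-- `X` is a singleton picking-exchange mechanism with parameters `P`. -/
def Mechanism.IsSingletonPickingExchangeWith {m : ℕ} (X : Mechanism m)
    (P : PickingExchangeData m) : Prop :=
  P.IsSingleton ∧ X.IsPickingExchangeWith P

/-- `X` is a singleton picking-exchange mechanism. -/
def Mechanism.IsSingletonPickingExchange {m : ℕ} (X : Mechanism m) : Prop :=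
  ∃ P : PickingExchangeData m, X.IsSingletonPickingExchangeWith P

/-! For impossibility, valuations `(m + 1) * p + 1` turn a truthful EF1 mechanism into a rule on
natural weights, where truthfulness and EF1 survive as weak inequalities and zero weights are
allowed. If both players want only `c`, whoever receives `c` commands it (`commands_of_mem`), so
among five items one player commands three. Giving the remaining items weight zero leaves exactly
five items, and ten weight vectors then yield a contradiction (`FairIndicator.false`).

For the singleton mechanisms, a player with `N i` empty faces a bundle of at most one item.
Otherwise she holds her favourite item of `N i`, which compensates for an item of `N i` held by the
other player. In the sizes considered, at most one further item remains there, and it can be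
removed. -/

/-! ### Rules on natural weights and commanded items -/

/-- An allocation rule for two players with natural-number weights on the items `α`, given by the
bundle of the first player; it is truthful and envy-free up to one item. -/
structure IsFairRule {α : Type*} [Fintype α] [DecidableEq α]
    (A : (α → ℕ) → (α → ℕ) → Finset α) : Prop where
  truthful_left : ∀ p p' q, ∑ k ∈ A p' q, p k ≤ ∑ k ∈ A p q, p k
  truthful_right : ∀ p q q', ∑ k ∈ (A p q')ᶜ, q k ≤ ∑ k ∈ (A p q)ᶜ, q k
  -- The removed item need not lie in the bundle, which covers empty bundles.
  ef1_left : ∀ p q, ∃ a, ∑ k ∈ (A p q)ᶜ \ {a}, p k ≤ ∑ k ∈ A p q, p k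
  ef1_right : ∀ p q, ∃ a, ∑ k ∈ A p q \ {a}, q k ≤ ∑ k ∈ (A p q)ᶜ, q k

/-- The first player receives `c` whenever it outweighs all the other items together for her. -/
def Commands {α : Type*} [Fintype α] [DecidableEq α]
    (A : (α → ℕ) → (α → ℕ) → Finset α) (c : α) : Prop :=
  ∀ p q, ∑ k, p k < 2 * p c → c ∈ A p q

namespace IsFairRule

variable {α β : Type*} [Fintype α] [DecidableEq α] [Fintype β] [DecidableEq β]
  {A : (α → ℕ) → (α → ℕ) → Finset α}

theorem swap (h : IsFairRule A) : IsFairRule (fun p q => (A q p)ᶜ) where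
  truthful_left p p' q := h.truthful_right q p p'
  truthful_right p q q' := by simpa using h.truthful_left q q' p
  ef1_left p q := by simpa using h.ef1_right q p
  ef1_right p q := by simpa using h.ef1_left q p

/-- If the second player wants only `c` and misses it, no report of hers may win it. So the first
player can always secure `c` by claiming to want only `c`, and when `c` is worth more than half the
total, a bundle without it would be worse. -/
theorem commands_of_mem (h : IsFairRule A) {c : α}
    (hc : c ∈ A (Pi.single c 1) (Pi.single c 1)) : Commands A c := by
  intro p q hp
  have h1 : c ∈ A (Pi.single c 1) q := by
    have := h.truthful_right (Pi.single c 1) (Pi.single c 1) q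
    simpa [Finset.sum_pi_single, hc] using this
  by_contra hn
  have h2 := h.truthful_left p (Pi.single c 1) q
  have h3 : p c ≤ ∑ k ∈ A (Pi.single c 1) q, p k :=
    Finset.single_le_sum (f := p) (fun _ _ => Nat.zero_le _) h1
  have h4 : ∑ k ∈ insert c (A p q), p k ≤ ∑ k, p k :=
    Finset.sum_le_sum_of_subset (Finset.subset_univ _)
  rw [Finset.sum_insert hn] at h4
  omega

theorem commands_or (h : IsFairRule A) (c : α) :
    Commands A c ∨ Commands (fun p q => (A q p)ᶜ) c := by
  by_cases hc : c ∈ A (Pi.single c 1) (Pi.single c 1)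
  · exact .inl (h.commands_of_mem hc)
  · exact .inr (h.swap.commands_of_mem (by simpa using hc))

end IsFairRule

/-! ### Reduction to five items -/

/-- The rule induced on the items `β` by giving weight zero to the items outside the range of
`e`. -/
noncomputable def restrictRule {α β : Type*} (e : β ↪ α)
    (A : (α → ℕ) → (α → ℕ) → Finset α) (p q : β → ℕ) : Finset β :=
  (A (Function.extend e p 0) (Function.extend e q 0)).preimage e e.injective.injOn

theorem sum_extend_eq_sum_preimage {α β : Type*} (e : β ↪ α) (p : β → ℕ) (S : Finset α) :
    ∑ k ∈ S, Function.extend e p 0 k = ∑ c ∈ S.preimage e e.injective.injOn, p c := by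
  rw [← Finset.sum_preimage e S e.injective.injOn (Function.extend e p 0)]
  · simp [e.injective.extend_apply]
  · intro x _ hx
    rw [Function.extend_apply' _ _ _ (by simpa using hx)]
    rfl

section

variable {α β : Type*} [Fintype α] [DecidableEq α] [Fintype β] [DecidableEq β]
  {A : (α → ℕ) → (α → ℕ) → Finset α}

theorem IsFairRule.restrict [Nonempty β] (h : IsFairRule A) (e : β ↪ α) :
    IsFairRule (restrictRule e A) := by
  have compl_eq (S : Finset α) : (S.preimage e e.injective.injOn)ᶜ
      = Sᶜ.preimage e e.injective.injOn := by ext; simp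
  have remove (S : Finset α) (a : α) (p : β → ℕ) : ∃ c, ∑ k ∈ S.preimage e e.injective.injOn \ {c},
      p k ≤ ∑ k ∈ S \ {a}, Function.extend e p 0 k := by
    rw [sum_extend_eq_sum_preimage]
    by_cases ha : ∃ c, e c = a
    · obtain ⟨c, rfl⟩ := ha
      exact ⟨c, Finset.sum_le_sum_of_subset fun x => by simp⟩
    -- An item outside the range weighs nothing, so any item of `β` can replace it.
    · obtain ⟨c⟩ := ‹Nonempty β›
      exact ⟨c, Finset.sum_le_sum_of_subset fun x hx => by
        simp only [Finset.mem_sdiff, Finset.mem_preimage, Finset.mem_singleton] at hx ⊢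
        exact ⟨hx.1, fun h => ha ⟨x, h⟩⟩⟩
  constructor
  · intro p p' q
    simpa only [restrictRule, ← sum_extend_eq_sum_preimage] using h.truthful_left _ _ _
  · intro p q q'
    simpa only [restrictRule, compl_eq, ← sum_extend_eq_sum_preimage] using h.truthful_right _ _ _
  · intro p q
    obtain ⟨a, ha⟩ := h.ef1_left (Function.extend e p 0) (Function.extend e q 0)
    obtain ⟨c, hc⟩ := remove _ a p
    refine ⟨c, ?_⟩
    simp only [restrictRule, compl_eq]
    exact (hc.trans ha).trans_eq (sum_extend_eq_sum_preimage _ _ _)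
  · intro p q
    obtain ⟨a, ha⟩ := h.ef1_right (Function.extend e p 0) (Function.extend e q 0)
    obtain ⟨c, hc⟩ := remove _ a q
    refine ⟨c, ?_⟩
    simp only [restrictRule, compl_eq]
    exact (hc.trans ha).trans_eq (sum_extend_eq_sum_preimage _ _ _)

theorem Commands.restrict {e : β ↪ α} {c : β} (h : Commands A (e c)) :
    Commands (restrictRule e A) c := by
  intro p q hp
  have h1 := sum_extend_eq_sum_preimage e p Finset.univ
  rw [Finset.preimage_univ] at h1
  simpa [restrictRule] using h _ (Function.extend e q 0)
    (by rw [h1, e.injective.extend_apply]; exact hp)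

theorem exists_embedding_of_two_lt_card {s : Finset α} (hs : 2 < s.card)
    (hα : 5 ≤ Fintype.card α) : ∃ e : Fin 5 ↪ α, e 0 ∈ s ∧ e 1 ∈ s ∧ e 2 ∈ s := by
  obtain ⟨x, hx, y, hy, z, hz, hxy, hxz, hyz⟩ := Finset.two_lt_card.1 hs
  have h2 : 1 < (({x, y, z} : Finset α)ᶜ).card := by
    have := Finset.card_le_three (a := x) (b := y) (c := z)
    rw [Finset.card_compl]
    omega
  obtain ⟨u, hu, w, hw, huw⟩ := Finset.one_lt_card.1 h2
  simp only [Finset.mem_compl, Finset.mem_insert, Finset.mem_singleton, not_or] at hu hw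
  obtain ⟨hu1, hu2, hu3⟩ := hu
  obtain ⟨hw1, hw2, hw3⟩ := hw
  refine ⟨⟨![x, y, z, u, w], ?_⟩, hx, hy, hz⟩
  have : [x, y, z, u, w].Nodup := by simp; tauto
  have hget : (![x, y, z, u, w] : Fin 5 → α) = [x, y, z, u, w].get := by
    funext i
    fin_cases i <;> rfl
  rw [hget]
  exact List.nodup_iff_injective_get.1 this

/-- A fair rule on at least five items yields one on exactly five items whose first player commands
three of them. -/
theorem IsFairRule.exists_commands (h : IsFairRule A) (hα : 5 ≤ Fintype.card α) :
    ∃ B : (Fin 5 → ℕ) → (Fin 5 → ℕ) → Finset (Fin 5),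
      IsFairRule B ∧ Commands B 0 ∧ Commands B 1 ∧ Commands B 2 := by
  classical
  have main (A : (α → ℕ) → (α → ℕ) → Finset α) (h : IsFairRule A) (s : Finset α) (hs : 2 < s.card)
      (hc : ∀ c ∈ s, Commands A c) : ∃ B : (Fin 5 → ℕ) → (Fin 5 → ℕ) → Finset (Fin 5),
      IsFairRule B ∧ Commands B 0 ∧ Commands B 1 ∧ Commands B 2 := by
    obtain ⟨e, h0, h1, h2⟩ := exists_embedding_of_two_lt_card hs hα
    exact ⟨_, h.restrict e, (hc _ h0).restrict, (hc _ h1).restrict, (hc _ h2).restrict⟩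
  have hcard := Finset.card_filter_add_card_filter_not (s := Finset.univ)
    (fun c : α => Commands A c)
  rw [Finset.card_univ] at hcard
  -- If the first player commands at most two items, the second commands the other three or more,
  -- and the roles are swapped.
  rcases le_or_gt (Finset.univ.filter fun c : α => Commands A c).card 2 with h2 | h2
  · refine main _ h.swap (Finset.univ.filter fun c : α => ¬ Commands A c) (by omega) fun c hc => ?_
    exact (h.commands_or c).resolve_left (by simpa using hc)
  · exact main A h _ h2 fun c hc => by simpa using hc

end

/-! ### The contradiction on five items -/

/-- The conditions on a fair rule on five items whose first player commands three of them, as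
linear inequalities for the indicators of the bundle of the first player. -/
structure FairIndicator (b : (Fin 5 → ℕ) → (Fin 5 → ℕ) → Fin 5 → ℕ) : Prop where
  le_one : ∀ p q, b p q 0 ≤ 1 ∧ b p q 1 ≤ 1 ∧ b p q 2 ≤ 1 ∧ b p q 3 ≤ 1 ∧ b p q 4 ≤ 1
  truthful_left : ∀ {p x y z u w}, p = ![x, y, z, u, w] → ∀ p' q,
    x * b p' q 0 + y * b p' q 1 + z * b p' q 2 + u * b p' q 3 + w * b p' q 4 ≤
      x * b p q 0 + y * b p q 1 + z * b p q 2 + u * b p q 3 + w * b p q 4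
  -- The total is fixed, so the second player maximizes her bundle by minimizing the first player's.
  truthful_right : ∀ {q x y z u w}, q = ![x, y, z, u, w] → ∀ p q',
    x * b p q 0 + y * b p q 1 + z * b p q 2 + u * b p q 3 + w * b p q 4 ≤
      x * b p q' 0 + y * b p q' 1 + z * b p q' 2 + u * b p q' 3 + w * b p q' 4
  ef1_left : ∀ {p x y z u w}, p = ![x, y, z, u, w] → ∀ q s,
    s = x * b p q 0 + y * b p q 1 + z * b p q 2 + u * b p q 3 + w * b p q 4 →
      (x + y + z + u + w ≤ 2 * s + x * (1 - b p q 0) ∨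
        x + y + z + u + w ≤ 2 * s + y * (1 - b p q 1) ∨
        x + y + z + u + w ≤ 2 * s + z * (1 - b p q 2) ∨
        x + y + z + u + w ≤ 2 * s + u * (1 - b p q 3) ∨
        x + y + z + u + w ≤ 2 * s + w * (1 - b p q 4))
  ef1_right : ∀ {q x y z u w}, q = ![x, y, z, u, w] → ∀ p s,
    s = x * b p q 0 + y * b p q 1 + z * b p q 2 + u * b p q 3 + w * b p q 4 →
      (2 * s ≤ x + y + z + u + w + x * b p q 0 ∨
        2 * s ≤ x + y + z + u + w + y * b p q 1 ∨
        2 * s ≤ x + y + z + u + w + z * b p q 2 ∨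
        2 * s ≤ x + y + z + u + w + u * b p q 3 ∨
        2 * s ≤ x + y + z + u + w + w * b p q 4)
  top_zero : ∀ {p x y z u w}, p = ![x, y, z, u, w] → ∀ q, y + z + u + w < x → b p q 0 = 1
  top_one : ∀ {p x y z u w}, p = ![x, y, z, u, w] → ∀ q, x + z + u + w < y → b p q 1 = 1
  top_two : ∀ {p x y z u w}, p = ![x, y, z, u, w] → ∀ q, x + y + u + w < z → b p q 2 = 1

theorem IsFairRule.exists_fairIndicator {B : (Fin 5 → ℕ) → (Fin 5 → ℕ) → Finset (Fin 5)}
    (h : IsFairRule B) (h0 : Commands B 0) (h1 : Commands B 1) (h2 : Commands B 2) :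
    ∃ b, FairIndicator b := by
  have hsum (p : Fin 5 → ℕ) (S : Finset (Fin 5)) :
      ∑ k ∈ S, p k = p 0 * (if 0 ∈ S then 1 else 0) + p 1 * (if 1 ∈ S then 1 else 0) +
        p 2 * (if 2 ∈ S then 1 else 0) + p 3 * (if 3 ∈ S then 1 else 0) +
        p 4 * (if 4 ∈ S then 1 else 0) := by
    rw [← Fin.sum_univ_five fun k => p k * if k ∈ S then 1 else 0]
    simp
  have hsub (i : Fin 5) (S : Finset (Fin 5)) : (if i ∈ Sᶜ then 1 else 0) =
      1 - (if i ∈ S then 1 else 0) := by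
    by_cases hi : i ∈ S <;> simp [hi]
  have hdiff (p : Fin 5 → ℕ) (S : Finset (Fin 5)) (a : Fin 5) :
      ∑ k ∈ S, p k = ∑ k ∈ S \ {a}, p k + p a * (if a ∈ S then 1 else 0) := by
    by_cases ha : a ∈ S
    · rw [← Finset.sum_sdiff (Finset.singleton_subset_iff.2 ha)]; simp [ha]
    · rw [Finset.sdiff_singleton_eq_erase, Finset.erase_eq_of_notMem ha]; simp [ha]
  have htot (p : Fin 5 → ℕ) (S : Finset (Fin 5)) : ∑ k ∈ S, p k + ∑ k ∈ Sᶜ, p k = ∑ k, p k :=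
    Finset.sum_add_sum_compl S p
  refine ⟨fun p q i => if i ∈ B p q then 1 else 0, ?_, ?_, ?_, ?_, ?_, ?_, ?_, ?_⟩
  · intro p q
    refine ⟨?_, ?_, ?_, ?_, ?_⟩ <;> split_ifs <;> simp
  · rintro _ x y z u w rfl p' q
    have := h.truthful_left ![x, y, z, u, w] p' q
    rw [hsum, hsum] at this
    exact this
  · rintro _ x y z u w rfl p q'
    have := h.truthful_right p ![x, y, z, u, w] q'
    have : ∑ k ∈ B p ![x, y, z, u, w], ![x, y, z, u, w] k ≤
        ∑ k ∈ B p q', ![x, y, z, u, w] k := by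
      have := htot ![x, y, z, u, w] (B p ![x, y, z, u, w])
      have := htot ![x, y, z, u, w] (B p q')
      omega
    rw [hsum, hsum] at this
    exact this
  · rintro _ x y z u w rfl q s hs
    obtain ⟨a, ha⟩ := h.ef1_left ![x, y, z, u, w] q
    have e1 := hdiff ![x, y, z, u, w] (B ![x, y, z, u, w] q)ᶜ a
    have e2 := htot ![x, y, z, u, w] (B ![x, y, z, u, w] q)
    rw [hsub] at e1
    rw [(hsum ![x, y, z, u, w] (B ![x, y, z, u, w] q)).trans hs.symm] at ha e2
    rw [Fin.sum_univ_five] at e2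
    change _ = x + y + z + u + w at e2
    have key : x + y + z + u + w ≤ 2 * s + ![x, y, z, u, w] a *
        (1 - if a ∈ B ![x, y, z, u, w] q then 1 else 0) := by omega
    clear e1 e2 ha hs
    fin_cases a
    · exact .inl key
    · exact .inr (.inl key)
    · exact .inr (.inr (.inl key))
    · exact .inr (.inr (.inr (.inl key)))
    · exact .inr (.inr (.inr (.inr key)))
  · rintro _ x y z u w rfl p s hs
    obtain ⟨a, ha⟩ := h.ef1_right p ![x, y, z, u, w]
    have e1 := hdiff ![x, y, z, u, w] (B p ![x, y, z, u, w]) a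
    have e2 := htot ![x, y, z, u, w] (B p ![x, y, z, u, w])
    rw [(hsum ![x, y, z, u, w] (B p ![x, y, z, u, w])).trans hs.symm] at e1 e2
    rw [Fin.sum_univ_five] at e2
    change _ = x + y + z + u + w at e2
    have key : 2 * s ≤ x + y + z + u + w + ![x, y, z, u, w] a *
        (if a ∈ B p ![x, y, z, u, w] then 1 else 0) := by omega
    clear e1 e2 ha hs
    fin_cases a
    · exact .inl key
    · exact .inr (.inl key)
    · exact .inr (.inr (.inl key))
    · exact .inr (.inr (.inr (.inl key)))
    · exact .inr (.inr (.inr (.inr key)))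
  · rintro _ x y z u w rfl q hlt
    exact if_pos (h0 _ _ (by rw [Fin.sum_univ_five]; change x + y + z + u + w < 2 * x; omega))
  · rintro _ x y z u w rfl q hlt
    exact if_pos (h1 _ _ (by rw [Fin.sum_univ_five]; change x + y + z + u + w < 2 * y; omega))
  · rintro _ x y z u w rfl q hlt
    exact if_pos (h2 _ _ (by rw [Fin.sum_univ_five]; change x + y + z + u + w < 2 * z; omega))

/-- The items are `x, y, z, u, w`, and the first player commands `x, y, z`. The weights are named
after the three heaviest items in decreasing order. -/
theorem FairIndicator.false {b : (Fin 5 → ℕ) → (Fin 5 → ℕ) → Fin 5 → ℕ} (h : FairIndicator b) :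
    False := by
  obtain ⟨hb, truthL, truthR, efL, efR, h0, h1, h2⟩ := h
  -- Except for `flat`, the weights are permuted powers of two, so bundles compare lexicographically
  -- and EF1 says exactly that the other player does not hold both of one's two heaviest items. The
  -- vectors are kept opaque so that `omega` treats the indicators as atoms.
  obtain ⟨yxz, hyxz⟩ : ∃ p : Fin 5 → ℕ, p = ![8, 16, 4, 2, 1] := ⟨_, rfl⟩
  obtain ⟨flat, hflat⟩ : ∃ p : Fin 5 → ℕ, p = ![2, 3, 3, 1, 3] := ⟨_, rfl⟩
  obtain ⟨zyw, hzyw⟩ : ∃ p : Fin 5 → ℕ, p = ![2, 8, 16, 1, 4] := ⟨_, rfl⟩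
  obtain ⟨xyz, hxyz⟩ : ∃ p : Fin 5 → ℕ, p = ![16, 8, 4, 1, 2] := ⟨_, rfl⟩
  obtain ⟨zxy, hzxy⟩ : ∃ p : Fin 5 → ℕ, p = ![8, 4, 16, 2, 1] := ⟨_, rfl⟩
  obtain ⟨wzu, hwzu⟩ : ∃ p : Fin 5 → ℕ, p = ![1, 2, 8, 4, 16] := ⟨_, rfl⟩
  obtain ⟨xwu, hxwu⟩ : ∃ p : Fin 5 → ℕ, p = ![16, 2, 1, 4, 8] := ⟨_, rfl⟩
  obtain ⟨yzw, hyzw⟩ : ∃ p : Fin 5 → ℕ, p = ![2, 16, 8, 1, 4] := ⟨_, rfl⟩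
  obtain ⟨wyu, hwyu⟩ : ∃ p : Fin 5 → ℕ, p = ![1, 8, 2, 4, 16] := ⟨_, rfl⟩
  obtain ⟨yxw, hyxw⟩ : ∃ p : Fin 5 → ℕ, p = ![8, 16, 2, 1, 4] := ⟨_, rfl⟩
  have top_xyz : ∀ q, b xyz q 0 = 1 := fun q => h0 hxyz q (by norm_num)
  have top_yxz : ∀ q, b yxz q 1 = 1 := fun q => h1 hyxz q (by norm_num)
  have top_zyw : ∀ q, b zyw q 2 = 1 := fun q => h2 hzyw q (by norm_num)
  have := top_xyz wyu
  have := top_xyz wzu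
  have := top_xyz xwu
  have := top_xyz yxw
  have := top_xyz yzw
  have := top_xyz zxy
  have := top_yxz wyu
  have := top_yxz wzu
  have := top_yxz xwu
  have := top_yxz yxw
  have := top_yxz zxy
  have := top_zyw wyu
  have := top_zyw wzu
  have := top_zyw yxw
  have := top_zyw yzw
  -- The typical propagation: since `y` is commanded, EF1 at report `yxw` gives `x` to the second
  -- player. She can then also secure `x` when it is her heaviest item.
  have : b yxz xwu 0 = 0 := by
    have := efR hyxw yxz _ rfl
    have := truthR hxwu yxz yxw
    have := hb yxz xwu; have := hb yxz yxw
    omega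
  have : b xyz xwu 1 = 0 ∧ b xyz xwu 4 = 0 := by
    have := efR hxwu xyz _ rfl
    have := truthL hyxz xyz xwu
    have := hb xyz xwu; have := hb yxz xwu
    omega
  have : b xyz wyu 1 = 0 ∧ b xyz wyu 4 = 0 := by
    have := truthR hwyu xyz xwu
    have := hb xyz xwu; have := hb xyz wyu
    omega
  have : b yxz wyu 0 = 0 ∧ b yxz wyu 4 = 0 := by
    have := efR hwyu yxz _ rfl
    have := truthL hxyz yxz wyu
    have := hb yxz wyu; have := hb xyz wyu
    omega
  have : b zyw yxw 1 = 0 := by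
    have := efR hyzw zyw _ rfl
    have := truthR hyxw zyw yzw
    have := hb zyw yzw; have := hb zyw yxw
    omega
  have : b yxz yxw 0 = 0 ∧ b yxz yxw 2 = 0 := by
    have := efR hyxw yxz _ rfl
    have := truthL hzyw yxz yxw
    have := hb zyw yxw; have := hb yxz yxw
    omega
  have : b yxz zxy 0 = 0 ∧ b yxz zxy 2 = 0 := by
    have := truthR hzxy yxz yxw
    have := hb yxz yxw; have := hb yxz zxy
    omega
  have : b xyz zxy 1 = 0 ∧ b xyz zxy 2 = 0 := by
    have := efR hzxy xyz _ rfl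
    have := truthL hyxz xyz zxy
    have := hb yxz zxy; have := hb xyz zxy
    omega
  have : b xyz yzw 1 = 0 ∧ b xyz yzw 2 = 0 := by
    have := truthR hyzw xyz zxy
    have := hb xyz yzw; have := hb xyz zxy
    omega
  have : b zyw yzw 0 = 0 ∧ b zyw yzw 1 = 0 := by
    have := efR hyzw zyw _ rfl
    have := truthL hxyz zyw yzw
    have := hb zyw yzw; have := hb xyz yzw
    omega
  have : b yxz wzu 0 = 0 ∧ b yxz wzu 2 = 0 ∧ b yxz wzu 4 = 0 := by
    have := truthR hwzu yxz yxw
    have := truthR hwyu yxz wzu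
    have := truthR hyxw yxz wyu
    have := hb yxz wzu; have := hb yxz wyu; have := hb yxz yxw
    omega
  have : b zyw wzu 1 = 0 ∧ b zyw wzu 4 = 0 := by
    have := efR hwzu zyw _ rfl
    have := truthL hyxz zyw wzu
    have := hb yxz wzu; have := hb zyw wzu
    omega
  have : b xyz wzu 1 = 0 := by
    have := truthL hyxz xyz wzu
    have := hb xyz wzu; have := hb yxz wzu
    omega
  have : b zyw wyu 1 = 0 ∧ b zyw wyu 4 = 0 := by
    have := truthR hwyu zyw wzu
    have := hb zyw wyu; have := hb zyw wzu
    omega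
  -- The items `y`, `z`, `w` weigh 3 in `flat`, and at most one is received: `z` with another would
  -- tempt `zyw` to misreport, and `y` with `w` would violate EF1 for `wyu`. Of the total 12, the
  -- first player's EF1 demands at least 5, hence `x` besides one of the three.
  have : b flat wyu 0 = 1 := by
    have := efL hflat wyu _ rfl
    have := efR hwyu flat _ rfl
    have := truthL hzyw flat wyu
    have := hb zyw wyu; have := hb flat wyu
    have : b flat wyu 2 = 0 ∨ b flat wyu 2 = 1 := by omega
    have : b flat wyu 4 = 0 ∨ b flat wyu 4 = 1 := by omega
    omega
  -- Reporting `flat` secures `x` and one of `y`, `z`, `w`. Since `xyz` gets neither `y` nor `w`,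
  -- only `z` can match this.
  have : b xyz wyu 2 = 1 := by
    have := efL hflat wyu _ rfl
    have := truthL hxyz flat wyu
    have := hb xyz wyu; have := hb flat wyu
    omega
  have : b zyw wyu 0 = 1 := by
    have := truthL hzyw xyz wyu
    have := hb zyw wyu; have := hb xyz wyu
    omega
  have : b zyw yzw 3 = 1 ∧ b zyw yzw 4 = 0 := by
    have := truthR hyzw zyw wyu
    have := truthR hwyu zyw yzw
    have := hb zyw yzw; have := hb zyw wyu
    omega
  have : b zyw yxw 0 = 0 ∧ b zyw yxw 3 = 1 ∧ b zyw yxw 4 = 0 := by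
    have := truthR hyxw zyw yzw
    have := truthR hyzw zyw yxw
    have := hb zyw yzw; have := hb zyw yxw
    omega
  have : b xyz yxw 1 = 0 ∧ b xyz yxw 2 = 0 := by
    have := efR hyxw xyz _ rfl
    have := truthL hzyw xyz yxw
    have := hb zyw yxw; have := hb xyz yxw
    omega
  have : b zyw wzu 0 = 1 := by
    have := truthR hwzu zyw wyu
    have := truthR hwyu zyw wzu
    have := hb zyw wyu; have := hb zyw wzu
    omega
  have : b xyz wzu 2 = 1 ∧ b xyz wzu 4 = 0 := by
    have := truthL hxyz zyw wzu
    have := truthL hzyw xyz wzu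
    have := hb xyz wzu; have := hb zyw wzu
    omega
  -- Against `xyz`, report `wzu` leaves `x`, `z` and possibly `u` to the first player, while `yxw`
  -- leaves her `x` and possibly `u`, `w`. Truthfulness of `wzu` forces `w` into the latter bundle;
  -- then `yxw` would gain by reporting `wzu`, trading `z` for the heavier `w`.
  have := truthR hwzu xyz yxw
  have := truthR hyxw xyz wzu
  have := hb xyz wzu; have := hb xyz yxw
  omega

/-! ### From mechanisms to natural weights -/

/-- The valuation `(m + 1) * p + 1`: comparisons of bundles by it imply weak comparisons by the
integer weights `p`. -/
def ItemValuation.ofWeights {m : ℕ} (p : Fin m → ℕ) : ItemValuation m :=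
  ⟨fun k => ((m + 1) * p k + 1 : ℕ), fun k => by positivity⟩

/-- A weight deficit of one costs `m + 1`, more than the extra ones, at most `m` in all, can make
up. -/
theorem ItemValuation.sum_le_of_value_ofWeights_le {m : ℕ} {p : Fin m → ℕ} {S T : Finset (Fin m)}
    (h : (ofWeights p).value S ≤ (ofWeights p).value T) : ∑ k ∈ S, p k ≤ ∑ k ∈ T, p k := by
  have h1 : ∑ k ∈ S, ((m + 1) * p k + 1) ≤ ∑ k ∈ T, ((m + 1) * p k + 1) := by
    have h' : ∑ k ∈ S, (((m + 1) * p k + 1 : ℕ) : ℝ) ≤ ∑ k ∈ T, (((m + 1) * p k + 1 : ℕ) : ℝ) := h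
    exact_mod_cast h'
  simp only [Finset.sum_add_distrib, ← Finset.mul_sum, Finset.sum_const, smul_eq_mul,
    mul_one] at h1
  have h2 : T.card ≤ m := by simpa using Finset.card_le_univ T
  by_contra! h3
  nlinarith [Nat.mul_le_mul_left (m + 1) (Nat.succ_le_of_lt h3)]

theorem Allocation.compl_bundle_zero {m : ℕ} (A : Allocation m) : (A.bundle 0)ᶜ = A.bundle 1 :=
  (IsCompl.of_eq (by simpa using A.disjoint.eq_bot) (by simpa using A.cover)).compl_eq

/-- The allocation rule on integer weights induced by a mechanism. -/
noncomputable def Mechanism.weightRule {m : ℕ} (X : Mechanism m) (p q : Fin m → ℕ) :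
    Finset (Fin m) :=
  (X ![ItemValuation.ofWeights p, ItemValuation.ofWeights q]).bundle 0

theorem Mechanism.isFairRule_weightRule {m : ℕ} [NeZero m] {X : Mechanism m} (hT : X.IsTruthful)
    (hE : X.AchievesEF1) : IsFairRule X.weightRule := by
  constructor
  · intro p p' q
    have := hT ![.ofWeights p, .ofWeights q] 0 (.ofWeights p')
    have hu : Function.update ![ItemValuation.ofWeights p, .ofWeights q] 0 (.ofWeights p') =
        ![.ofWeights p', .ofWeights q] := by ext i; fin_cases i <;> rfl
    rw [hu] at this
    exact ItemValuation.sum_le_of_value_ofWeights_le this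
  · intro p q q'
    have := hT ![.ofWeights p, .ofWeights q] 1 (.ofWeights q')
    have hu : Function.update ![ItemValuation.ofWeights p, .ofWeights q] 1 (.ofWeights q') =
        ![.ofWeights p, .ofWeights q'] := by ext i; fin_cases i <;> rfl
    rw [hu] at this
    simp only [weightRule, Allocation.compl_bundle_zero]
    exact ItemValuation.sum_le_of_value_ofWeights_le this
  · intro p q
    simp only [weightRule, Allocation.compl_bundle_zero]
    have := hE ![.ofWeights p, .ofWeights q] 0 1 (by simp)
    rcases Finset.eq_empty_or_nonempty
      ((X ![.ofWeights p, .ofWeights q]).bundle 1) with h | h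
    · exact ⟨0, by simp [h]⟩
    · obtain ⟨a, -, ha⟩ := this h
      exact ⟨a, ItemValuation.sum_le_of_value_ofWeights_le ha⟩
  · intro p q
    simp only [weightRule, Allocation.compl_bundle_zero]
    have := hE ![.ofWeights p, .ofWeights q] 1 0 (by simp)
    rcases Finset.eq_empty_or_nonempty
      ((X ![.ofWeights p, .ofWeights q]).bundle 0) with h | h
    · exact ⟨0, by simp [h]⟩
    · obtain ⟨a, -, ha⟩ := this h
      exact ⟨a, ItemValuation.sum_le_of_value_ofWeights_le ha⟩

theorem not_exists_truthful_ef1 {m : ℕ} (hm : 5 ≤ m) :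
    ¬ ∃ X : Mechanism m, X.IsTruthful ∧ X.AchievesEF1 := by
  rintro ⟨X, hT, hE⟩
  have : NeZero m := ⟨by omega⟩
  obtain ⟨B, hB, h0, h1, h2⟩ :=
    (X.isFairRule_weightRule hT hE).exists_commands (by simpa using hm)
  obtain ⟨b, hb⟩ := hB.exists_fairIndicator h0 h1 h2
  exact hb.false

/-! ### Fairness of singleton picking-exchange mechanisms -/

theorem ItemValuation.value_mono {m : ℕ} (v : ItemValuation m) {S T : Finset (Fin m)}
    (h : S ⊆ T) : v.value S ≤ v.value T :=
  Finset.sum_le_sum_of_subset_of_nonneg h fun k _ _ => (v.2 k).le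

theorem ItemValuation.value_singleton {m : ℕ} (v : ItemValuation m) (k : Fin m) :
    v.value {k} = v.1 k := by
  simp [value]

namespace Allocation

variable {m : ℕ} (A : Allocation m) {i j : Fin 2}

theorem mem_bundle_iff_notMem (hij : i ≠ j) {k : Fin m} : k ∈ A.bundle j ↔ k ∉ A.bundle i := by
  have h : k ∈ A.bundle 1 ↔ k ∉ A.bundle 0 := by rw [← A.compl_bundle_zero, Finset.mem_compl]
  fin_cases i <;> fin_cases j
  · exact absurd rfl hij
  · exact h
  · exact (not_iff_comm.1 h.symm).symm
  · exact absurd rfl hij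

end Allocation

/-- If `i` holds an item worth at least `b` to her, then she does not envy a bundle that becomes a
part of `{b}` after the removal of one item. -/
theorem ItemValuation.value_sdiff_le {m : ℕ} (v : ItemValuation m) {S T : Finset (Fin m)}
    {a b c : Fin m} (hc : c ∈ T) (hbc : v.1 b ≤ v.1 c) (hS : S \ {a} ⊆ {b}) :
    v.value (S \ {a}) ≤ v.value T :=
  calc v.value (S \ {a}) ≤ v.value {b} := v.value_mono hS
    _ ≤ v.value {c} := by simpa only [value_singleton] using hbc
    _ ≤ v.value T := v.value_mono (by simpa using hc)

namespace Mechanism.IsSingletonPickingExchangeWith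

variable {m : ℕ} {X : Mechanism m} {P : PickingExchangeData m}

/-- From a nonempty `N i`, player `i` receives exactly one item, and it is a best one. -/
theorem exists_pick (h : X.IsSingletonPickingExchangeWith P) (v : Profile m) {i : Fin 2}
    (hN : (P.N i).Nonempty) : ∃ c, (X v).bundle i ∩ P.N i = {c} ∧
      ∀ b ∈ P.N i, (v i).1 b ≤ (v i).1 c := by
  obtain ⟨hO, hbest⟩ := (h.2 v).1 i
  rw [(h.1 i).2.2, if_pos hN] at hO hbest
  obtain ⟨c, hc, hce⟩ := Finset.mem_image.1 hO
  refine ⟨c, hce.symm, fun b hb => ?_⟩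
  have := hbest {b} (Finset.mem_image_of_mem _ hb)
  rwa [← hce, ItemValuation.value_singleton, ItemValuation.value_singleton] at this

/-- On `E 0 ∪ E 1`, each player either keeps her own part or, if both parts are nonempty, receives
that of the other player. -/
theorem inter_E (h : X.IsSingletonPickingExchangeWith P) (v : Profile m) :
    (X v).bundle 0 ∩ (P.E 0 ∪ P.E 1) = P.E 0 ∨
      (X v).bundle 0 ∩ (P.E 0 ∪ P.E 1) = P.E 1 ∧ (P.E 0).Nonempty ∧ (P.E 1).Nonempty := by
  obtain ⟨-, I, hI, -, -⟩ := h.2 v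
  rcases I.eq_empty_or_nonempty with rfl | ⟨l, hl⟩
  · exact .inl (by simpa using hI)
  · refine .inr ⟨?_, (P.S_nonempty l).mono (P.S_subset l), (P.T_nonempty l).mono (P.T_subset l)⟩
    -- As `E 0` and `E 1` have at most one item, any executed deal swaps them entirely.
    have hS : I.biUnion P.S = P.E 0 :=
      Finset.eq_of_subset_of_card_le (Finset.biUnion_subset.2 fun l _ => P.S_subset l)
        ((h.1 0).2.1.trans (Finset.card_pos.2 ((P.S_nonempty l).mono
          (Finset.subset_biUnion_of_mem P.S hl))))
    have hT : I.biUnion P.T = P.E 1 :=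
      Finset.eq_of_subset_of_card_le (Finset.biUnion_subset.2 fun l _ => P.T_subset l)
        ((h.1 1).2.1.trans (Finset.card_pos.2 ((P.T_nonempty l).mono
          (Finset.subset_biUnion_of_mem P.T hl))))
    rw [hI, hS, hT]
    simp

theorem _root_.PickingExchangeData.mem_cover (P : PickingExchangeData m) {i j : Fin 2} (hij : i ≠ j) (k : Fin m) :
    k ∈ P.N i ∨ k ∈ P.N j ∨ k ∈ P.E 0 ∪ P.E 1 := by
  have := P.cover.symm ▸ Finset.mem_univ k
  simp only [Finset.mem_union] at this ⊢
  fin_cases i <;> fin_cases j <;> simp_all <;> tauto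

/-- The part of a bundle in `E 0 ∪ E 1` has at most one item, and none if the player owns no item
of it. -/
theorem card_inter_E (h : X.IsSingletonPickingExchangeWith P) (v : Profile m) (j : Fin 2) :
    ((X v).bundle j ∩ (P.E 0 ∪ P.E 1)).card ≤ (P.E j).card := by
  have h0 := (h.1 0).2.1
  have h1 := (h.1 1).2.1
  have hd := P.disjoint_E
  have hone : (X v).bundle 1 ∩ (P.E 0 ∪ P.E 1) =
      (P.E 0 ∪ P.E 1) \ ((X v).bundle 0 ∩ (P.E 0 ∪ P.E 1)) := by
    ext k
    simp only [Finset.mem_inter, Finset.mem_sdiff,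
      (X v).mem_bundle_iff_notMem (show (0 : Fin 2) ≠ 1 by decide)]
    tauto
  rcases h.inter_E v with hE | ⟨hE, hn0, hn1⟩
  · fin_cases j
    · exact (congrArg Finset.card hE).le
    · change ((X v).bundle 1 ∩ _).card ≤ _
      rw [hone, hE, Finset.union_sdiff_cancel_left hd]
      rfl
  · have := hn0.card_pos
    have := hn1.card_pos
    fin_cases j
    · change ((X v).bundle 0 ∩ _).card ≤ (P.E 0).card
      rw [hE]
      omega
    · change ((X v).bundle 1 ∩ _).card ≤ (P.E 1).card
      rw [hone, hE, Finset.union_sdiff_cancel_right hd]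
      omega

/-- With `N i` empty, player `j` gets only her single pick from `N j` or at most one item of the
exchange part, never both, because `N j` or `E j` is empty. -/
theorem card_bundle_le_one (h : X.IsSingletonPickingExchangeWith P) (v : Profile m) {i j : Fin 2}
    (hij : i ≠ j) (hi : P.N i = ∅) : ((X v).bundle j).card ≤ 1 := by
  have hsub : (X v).bundle j ⊆
      ((X v).bundle j ∩ P.N j) ∪ ((X v).bundle j ∩ (P.E 0 ∪ P.E 1)) := by
    intro k hk
    have := P.mem_cover hij k
    simp only [hi, Finset.notMem_empty, false_or] at this
    simp only [Finset.mem_union, Finset.mem_inter] at this ⊢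
    tauto
  have hle := (Finset.card_le_card hsub).trans (Finset.card_union_le _ _)
  have hE := h.card_inter_E v j
  have hE1 := (h.1 j).2.1
  rcases (P.N j).eq_empty_or_nonempty with hj | hj
  · rw [hj, Finset.inter_empty, Finset.card_empty] at hle
    omega
  · obtain ⟨c, hc, -⟩ := h.exists_pick v hj
    have : P.E j = ∅ := (h.1 j).1.resolve_left hj.ne_empty
    rw [hc, Finset.card_singleton] at hle
    rw [this, Finset.card_empty] at hE
    omega

/-- From a nonempty `N i`, the other player receives an item that `i` values no more than one of
her own items. -/
theorem exists_left_over (h : X.IsSingletonPickingExchangeWith P) (v : Profile m) {i j : Fin 2}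
    (hij : i ≠ j) (hN : (P.N i).Nonempty) :
    ∃ c ∈ (X v).bundle i, ∃ b ∈ (X v).bundle j, (v i).1 b ≤ (v i).1 c := by
  obtain ⟨c, hc, hbest⟩ := h.exists_pick v hN
  have hcm : c ∈ (X v).bundle i ∩ P.N i := by simp [hc]
  have hmem := ((h.2 v).1 i).1
  have hne := (P.offers i).proper hN _ hmem
  obtain ⟨b, hb, hbn⟩ := Finset.exists_of_ssubset
    (Finset.ssubset_iff_subset_ne.2 ⟨Finset.inter_subset_right, hne⟩)
  refine ⟨c, (Finset.mem_inter.1 hcm).1, b, ?_, hbest b hb⟩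
  rw [(X v).mem_bundle_iff_notMem hij]
  exact fun hbi => hbn (Finset.mem_inter.2 ⟨hbi, hb⟩)

theorem achievesEF1_of_le_three (h : X.IsSingletonPickingExchangeWith P) (hm : m ≤ 3) :
    X.AchievesEF1 := by
  intro v i j hij hne
  rcases (P.N i).eq_empty_or_nonempty with hi | hi
  · obtain ⟨a, ha⟩ := Finset.card_eq_one.1
      (le_antisymm (h.card_bundle_le_one v hij hi) hne.card_pos)
    refine ⟨a, by simp [ha], ?_⟩
    rw [ha, sdiff_self]
    exact (v i).value_mono (Finset.empty_subset _)
  · obtain ⟨c, hc, b, hb, hbc⟩ := h.exists_left_over v hij hi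
    have hcj : c ∉ (X v).bundle j := by
      rw [(X v).mem_bundle_iff_notMem hij, not_not]
      exact hc
    -- The item `c` lies outside the other bundle, which therefore has at most two items, one of
    -- them `b`.
    have hcard : (insert c ((X v).bundle j)).card ≤ m := by
      simpa using Finset.card_le_univ (insert c ((X v).bundle j))
    rw [Finset.card_insert_of_notMem hcj] at hcard
    have herase : (((X v).bundle j).erase b).card ≤ 1 := by
      rw [Finset.card_erase_of_mem hb]
      omega
    rcases (((X v).bundle j).erase b).eq_empty_or_nonempty with he | ⟨a, ha⟩
    · refine ⟨b, hb, ?_⟩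
      rw [Finset.sdiff_singleton_eq_erase, he]
      exact (v i).value_mono (Finset.empty_subset _)
    · refine ⟨a, Finset.mem_of_mem_erase ha, (v i).value_sdiff_le hc hbc fun k hk => ?_⟩
      simp only [Finset.mem_sdiff, Finset.mem_singleton] at hk ⊢
      by_contra hkb
      exact hk.2 (Finset.card_le_one.1 herase k (Finset.mem_erase.2 ⟨hkb, hk.1⟩) a ha)

theorem achievesEF1_of_card_N_eq_two (h : X.IsSingletonPickingExchangeWith P)
    (hN : ∀ i, (P.N i).card = 2) : X.AchievesEF1 := by
  intro v i j hij hne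
  have hNe (i : Fin 2) : (P.N i).Nonempty := Finset.card_pos.1 (by rw [hN i]; norm_num)
  have hEe (i : Fin 2) : P.E i = ∅ := (h.1 i).1.resolve_left (hNe i).ne_empty
  obtain ⟨c, hc, hbest⟩ := h.exists_pick v (hNe i)
  obtain ⟨a, ha, -⟩ := h.exists_pick v (hNe j)
  have hcm : c ∈ (X v).bundle i ∩ P.N i := by simp [hc]
  have ham : a ∈ (X v).bundle j ∩ P.N j := by simp [ha]
  rw [Finset.mem_inter] at hcm ham
  obtain ⟨b, hb⟩ := Finset.card_eq_one.1 (show ((P.N i).erase c).card = 1 by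
    rw [Finset.card_erase_of_mem hcm.2, hN i])
  have hbN : b ∈ (P.N i).erase c := by simp [hb]
  -- The other bundle is the pick `a` from `N j` together with the leftover `b` of `N i`; removing
  -- `a` leaves `b`, worth no more than `c`.
  refine ⟨a, ham.1, (v i).value_sdiff_le hcm.1 (hbest b (Finset.mem_of_mem_erase hbN))
    fun k hk => ?_⟩
  rw [Finset.mem_sdiff, Finset.mem_singleton] at hk
  rw [← hb, Finset.mem_erase]
  have hki := ((X v).mem_bundle_iff_notMem hij).1 hk.1
  refine ⟨fun hkc => hki (hkc ▸ hcm.1), ?_⟩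
  rcases P.mem_cover hij k with hk' | hk' | hk'
  · exact hk'
  · have : k ∈ (X v).bundle j ∩ P.N j := Finset.mem_inter.2 ⟨hk.1, hk'⟩
    rw [ha, Finset.mem_singleton] at this
    exact absurd this hk.2
  · simp [hEe] at hk'

end Mechanism.IsSingletonPickingExchangeWith

theorem mainTheorem6 :
    (∀ m : ℕ, m ≤ 3 → ∀ X : Mechanism m, X.IsSingletonPickingExchange → X.AchievesEF1) ∧
    (∀ (X : Mechanism 4) (P : PickingExchangeData 4), X.IsSingletonPickingExchangeWith P →
      (P.N 0).card = 2 → (P.N 1).card = 2 → X.AchievesEF1) ∧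
    (∀ m : ℕ, 5 ≤ m → ¬ ∃ X : Mechanism m, X.IsTruthful ∧ X.AchievesEF1) := by
  refine ⟨fun m hm X ⟨P, h⟩ => h.achievesEF1_of_le_three hm, fun X P h h0 h1 => ?_,
    fun m hm => not_exists_truthful_ef1 hm⟩
  exact h.achievesEF1_of_card_N_eq_two (Fin.forall_fin_two.2 ⟨h0, h1⟩)
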